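/- Let $M$ be a smooth $n$-manifold and $E = TM\oplus T^*M$ with the pairing $\langle X+\xi, Y+\eta\rangle = \eta(X)+\xi(Y)$, the Dorfman bracket $[X+\xi,Y+\eta]_D=[X,Y]+\mathcal L_X\eta-\iota_Y d\xi$ and the Courant bracket $[e_1,e_2]_C=\tfrac12([e_1,e_2]_D-[e_2,e_1]_D)$. A generalized metric is a smooth rank-$n$ subbundle $V\subset E$ on which the pairing is positive definite. Put $V^+=V$, $V^-=V^\perp$, so that $E=V^+\oplus V^-$; let $e\mapsto e_+$ be the projection onto $V^+$ along $V^-$, let $\pi:E\to TM$ be the projection on the first summand, and for a vector field $X$ let $X^\pm$ be the unique section of $V^\pm$ with $\pi(X^\pm)=X$. The affine connection on $M$ induced by $V^+$ is $$\nabla^+_XY=\pi\big(([X^-,Y^+]_C)_+\big).$$ Let $g$ be a Riemannian metric, $b$ a smooth $2$-form and $\alpha$ a smooth $1$-form on $M$. Let $$V^+=\{X+gX+bX\},\qquad V^+_{d\alpha}=\{X+gX+bX+d\alpha X\}\qquad (X\in TM)$$ be two generalized metrics that differ by an exact term, where $gX=g(X,\cdot)$, $bX=\iota_Xb$ and $d\alpha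 X=\iota_X d\alpha$. Then the induced connections coincide: $\nabla^+_XY=\nabla^{+,d\alpha}_XY$ for all smooth vector fields $X,Y$ on $M$. -/

import Mathlib

open Set
open scoped Manifold ContDiff Topology Bundle

noncomputable section

namespace GeneralizedGeometry

/-- The model space `ℝⁿ`. -/
abbrev Model (n : ℕ) : Type := EuclideanSpace ℝ (Fin n)

section Objects

variable (n : ℕ) {M : Type*} [TopologicalSpace M] [ChartedSpace (Model n) M]

/-- The tangent space `T_x M`. -/
abbrev Tangent (x : M) : Type := TangentSpace (𝓡 n) x

/-- The cotangent space `T*_x M`. -/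
abbrev Cotangent (x : M) : Type := TangentSpace (𝓡 n) x →L[ℝ] ℝ

/-- The fibre `E_x = T_x M ⊕ T*_x M` of the generalized tangent bundle; `X + ξ` is `(X, ξ)`. -/
abbrev GTangent (x : M) : Type := Tangent n x × Cotangent n x

end Objects

section Sections

variable {n : ℕ} {M : Type*} [TopologicalSpace M] [ChartedSpace (Model n) M]
  [IsManifold (𝓡 n) ∞ M]

/-- Smoothness on a set `U` of a section of `TM`. -/
def SmoothVectorOn (X : ∀ x : M, Tangent n x) (U : Set M) : Prop :=
  ContMDiffOn (𝓡 n) ((𝓡 n).prod 𝓘(ℝ, Model n)) ∞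
    (fun x ↦ Bundle.TotalSpace.mk' (Model n) (E := fun x : M ↦ TangentSpace (𝓡 n) x) x (X x)) U

/-- Smoothness on a set `U` of a section of `T*M`. -/
def SmoothCovectorOn (ξ : ∀ x : M, Cotangent n x) (U : Set M) : Prop :=
  ContMDiffOn (𝓡 n) ((𝓡 n).prod 𝓘(ℝ, Model n →L[ℝ] ℝ)) ∞
    (fun x ↦ Bundle.TotalSpace.mk' (Model n →L[ℝ] ℝ)
      (E := fun x : M ↦ (TangentSpace (𝓡 n) x →L[ℝ] ℝ)) x (ξ x)) U

end Sections

section Forms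

variable (n : ℕ) (M : Type*) [TopologicalSpace M] [ChartedSpace (Model n) M]
  [IsManifold (𝓡 n) ∞ M]

/-- Smooth vector fields on `M`. -/
structure SmoothField where
  toFun : ∀ x : M, Tangent n x
  smooth : SmoothVectorOn toFun univ

/-- Smooth `1`-forms on `M`. -/
structure OneForm where
  toFun : ∀ x : M, Cotangent n x
  smooth : SmoothCovectorOn toFun univ

/-- Smooth `2`-forms on `M`; `b.toFun x u v` is `b_x(u, v)`, so `b.toFun x u` is `ι_u b`. -/
structure TwoForm where
  toFun : ∀ x : M, TangentSpace (𝓡 n) x →L[ℝ] TangentSpace (𝓡 n) x →L[ℝ] ℝ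
  alternating : ∀ (x : M) (u : TangentSpace (𝓡 n) x), toFun x u u = 0
  smooth : ContMDiff (𝓡 n) ((𝓡 n).prod 𝓘(ℝ, Model n →L[ℝ] Model n →L[ℝ] ℝ)) ∞
    (fun x ↦ Bundle.TotalSpace.mk' (Model n →L[ℝ] Model n →L[ℝ] ℝ)
      (E := fun x : M ↦ (TangentSpace (𝓡 n) x →L[ℝ] TangentSpace (𝓡 n) x →L[ℝ] ℝ)) x (toFun x))

/-- Smooth Riemannian metrics on `M`. -/
abbrev RiemannianMetric : Type _ :=
  Bundle.ContMDiffRiemannianMetric (𝓡 n) ∞ (Model n) (fun x : M ↦ TangentSpace (𝓡 n) x)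

end Forms

/-! ### Calculus of `1`-forms on `ℝⁿ` -/

/-- The exterior derivative `dθ(u, v) = (D_u θ)(v) - (D_v θ)(u)` of a `1`-form on `ℝⁿ`. -/
def extDerivModel {n : ℕ} (θ : Model n → Model n →L[ℝ] ℝ) (p : Model n) :
    Model n →L[ℝ] Model n →L[ℝ] ℝ :=
  fderiv ℝ θ p - (fderiv ℝ θ p).flip

/-- The Lie derivative of a `1`-form on `ℝⁿ`:
`(L_X θ)_i = X^j ∂_j θ_i + θ_j ∂_i X^j`. -/
def lieDerivModel {n : ℕ} (X : Model n → Model n) (θ : Model n → Model n →L[ℝ] ℝ) (p : Model n) :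
    Model n →L[ℝ] ℝ :=
  fderiv ℝ θ p (X p) + (θ p).comp (fderiv ℝ X p)

/-- `extDerivModel` is the exterior derivative of Mathlib in degree `1`. -/
theorem extDerivModel_apply {n : ℕ} (θ : Model n → Model n →L[ℝ] ℝ) (p u v : Model n)
    (h : DifferentiableAt ℝ θ p) :
    extDerivModel θ p u v =
      extDeriv (fun q ↦ ContinuousAlternatingMap.ofSubsingleton ℝ (Model n) ℝ (0 : Fin 1) (θ q))
        p ![u, v] := by
  have h' : DifferentiableAt ℝ (fun q ↦
      ContinuousAlternatingMap.ofSubsingleton ℝ (Model n) ℝ (0 : Fin 1) (θ q)) p :=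
    (ContinuousAlternatingMap.ofSubsingletonLIE (𝕜 := ℝ) (E := Model n) (F := ℝ)
      (0 : Fin 1)).differentiableAt.comp p h
  rw [extDeriv_apply h', Fin.sum_univ_two]
  simp [extDerivModel, Fin.removeNth, fderiv_clm_apply h (differentiableAt_const _)]
  ring

/-- `lieDerivModel` satisfies `(L_X θ)(Z) = X(θ(Z)) - θ([X, Z])`. -/
theorem lieDerivModel_apply {n : ℕ} (X Z : Model n → Model n) (θ : Model n → Model n →L[ℝ] ℝ)
    (p : Model n) (hθ : DifferentiableAt ℝ θ p) (hZ : DifferentiableAt ℝ Z p) :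
    lieDerivModel X θ p (Z p) =
      fderiv ℝ (fun q ↦ θ q (Z q)) p (X p) - θ p (VectorField.lieBracket ℝ X Z p) := by
  rw [show (fun q ↦ θ q (Z q)) = fun q ↦ (θ q) (Z q) from rfl, fderiv_clm_apply hθ hZ]
  simp [lieDerivModel, VectorField.lieBracket]

/-! ### Calculus of `1`-forms on a manifold

As for Mathlib's Lie bracket of vector fields, the operations at `x₀` are computed in the preferred
chart at `x₀`. -/

section Calculus

variable {n : ℕ} {M : Type*} [TopologicalSpace M] [ChartedSpace (Model n) M]

/-- The expression of a `1`-form in the chart at `x₀`. -/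
def formInChart (x₀ : M) (ξ : ∀ x : M, Cotangent n x) (p : Model n) : Model n →L[ℝ] ℝ :=
  (ξ ((extChartAt (𝓡 n) x₀).symm p)).comp
    (mfderivWithin 𝓘(ℝ, Model n) (𝓡 n) (extChartAt (𝓡 n) x₀).symm (range (𝓡 n)) p)

/-- The expression of a vector field in the chart at `x₀`. -/
def vectorInChart (x₀ : M) (X : ∀ x : M, Tangent n x) (p : Model n) : Model n :=
  VectorField.mpullbackWithin 𝓘(ℝ, Model n) (𝓡 n) (extChartAt (𝓡 n) x₀).symm X
    (range (𝓡 n)) p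

/-- The derivative at `x₀` of the chart at `x₀`. -/
def chartDeriv (x₀ : M) : TangentSpace (𝓡 n) x₀ →L[ℝ] Model n :=
  mfderiv (𝓡 n) 𝓘(ℝ, Model n) (extChartAt (𝓡 n) x₀) x₀

/-- `ι_u dξ` at `x₀`, for a `1`-form `ξ` and a tangent vector `u` at `x₀`, that is, the covector
`v ↦ dξ(u, v)`. -/
def contractExtDeriv (ξ : ∀ x : M, Cotangent n x) (x₀ : M) (u : Tangent n x₀) : Cotangent n x₀ :=
  (extDerivModel (formInChart x₀ ξ) (extChartAt (𝓡 n) x₀ x₀) (chartDeriv x₀ u)).comp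
    (chartDeriv x₀)

/-- The Lie derivative `L_X η` of a `1`-form `η`, at `x₀`. -/
def lieDeriv (X : ∀ x : M, Tangent n x) (η : ∀ x : M, Cotangent n x) (x₀ : M) : Cotangent n x₀ :=
  (lieDerivModel (vectorInChart x₀ X) (formInChart x₀ η) (extChartAt (𝓡 n) x₀ x₀)).comp
    (chartDeriv x₀)

/-! ### Brackets on the generalized tangent bundle -/

/-- The Dorfman bracket `[X + ξ, Y + η]_D = [X, Y] + L_X η - ι_Y dξ`. -/
def dorfman (e₁ e₂ : ∀ x : M, GTangent n x) (x : M) : GTangent n x :=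
  (VectorField.mlieBracket (𝓡 n) (fun y ↦ (e₁ y).1) (fun y ↦ (e₂ y).1) x,
    lieDeriv (fun y ↦ (e₁ y).1) (fun y ↦ (e₂ y).2) x
      - contractExtDeriv (fun y ↦ (e₁ y).2) x (e₂ x).1)

/-- The Courant bracket `[e₁, e₂]_C = ½ ([e₁, e₂]_D - [e₂, e₁]_D)`. -/
def courant (e₁ e₂ : ∀ x : M, GTangent n x) (x : M) : GTangent n x :=
  (1 / 2 : ℝ) • (dorfman e₁ e₂ x - dorfman e₂ e₁ x)

/-- The natural pairing `⟨X + ξ, Y + η⟩ = ι_X η + ι_Y ξ` on `E_x`. -/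
def pairing (x : M) : LinearMap.BilinForm ℝ (GTangent n x) :=
  LinearMap.mk₂ ℝ (fun u v ↦ v.2 u.1 + u.2 v.1)
    (by intro u u' v; simp; ring) (by intro c u v; simp; ring)
    (by intro u v v'; simp; ring) (by intro c u v; simp; ring)

@[simp] theorem pairing_apply (x : M) (u v : GTangent n x) :
    pairing x u v = v.2 u.1 + u.2 v.1 := rfl

theorem pairing_isRefl (x : M) : (pairing (n := n) x).IsRefl := by
  intro u v h
  simp only [pairing_apply] at h ⊢
  linarith

instance (x : M) : FiniteDimensional ℝ (Tangent n x) :=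
  inferInstanceAs (FiniteDimensional ℝ (Model n))

instance (x : M) : FiniteDimensional ℝ (Cotangent n x) :=
  inferInstanceAs (FiniteDimensional ℝ (Model n →L[ℝ] ℝ))

theorem finrank_tangent (x : M) : Module.finrank ℝ (Tangent n x) = n :=
  finrank_euclideanSpace_fin (𝕜 := ℝ) (n := n)

theorem finrank_cotangent (x : M) : Module.finrank ℝ (Cotangent n x) = n := by
  have h : Module.finrank ℝ (Model n →L[ℝ] ℝ) = n := by
    rw [← LinearMap.toContinuousLinearMap.finrank_eq (R := ℝ) (M := Model n →ₗ[ℝ] ℝ)]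
    rw [Module.finrank_linearMap]
    simp
  exact h

end Calculus

/-! ### Generalized metrics -/

section Metric

variable (n : ℕ) (M : Type*) [TopologicalSpace M] [ChartedSpace (Model n) M]
  [IsManifold (𝓡 n) ∞ M]

/-- A generalized metric: a smooth subbundle `V` of `TM ⊕ T*M`, of rank `n = dim M`, on which the
natural pairing is positive definite. -/
structure GeneralizedMetric where
  /-- The fibres of `V`. -/
  V : ∀ x : M, Submodule ℝ (GTangent n x)
  rank : ∀ x : M, Module.finrank ℝ (V x) = n
  posDef : ∀ (x : M) (u : GTangent n x), u ∈ V x → u ≠ 0 → 0 < pairing x u u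
  /-- `V` has smooth local frames. -/
  smooth : ∀ x₀ : M, ∃ U ∈ 𝓝 x₀, ∃ e : Fin n → ∀ x : M, GTangent n x,
    (∀ i, SmoothVectorOn (fun x ↦ (e i x).1) U ∧ SmoothCovectorOn (fun x ↦ (e i x).2) U) ∧
      ∀ x ∈ U, V x = Submodule.span ℝ (range fun i ↦ e i x)

end Metric

namespace GeneralizedMetric

variable {n : ℕ} {M : Type*} [TopologicalSpace M] [ChartedSpace (Model n) M]
  [IsManifold (𝓡 n) ∞ M]

/-- `V⁺ = V`. -/
def plus (G : GeneralizedMetric n M) (x : M) : Submodule ℝ (GTangent n x) := G.V x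

/-- `V⁻ = V^⊥`, the orthogonal complement for the natural pairing. -/
def minus (G : GeneralizedMetric n M) (x : M) : Submodule ℝ (GTangent n x) :=
  (pairing x).orthogonal (G.V x)

theorem isCompl (G : GeneralizedMetric n M) (x : M) : IsCompl (G.plus x) (G.minus x) := by
  refine (LinearMap.BilinForm.isCompl_orthogonal_iff_disjoint (pairing_isRefl x)).2 ?_
  rw [Submodule.disjoint_def]
  intro u hu hu'
  by_contra h
  exact (G.posDef x u hu h).ne' (hu' u hu)

theorem bijective_plus (G : GeneralizedMetric n M) (x : M) :
    Function.Bijective ((LinearMap.fst ℝ (Tangent n x) (Cotangent n x)).domRestrict (G.plus x)) := by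
  have hinj : Function.Injective
      ((LinearMap.fst ℝ (Tangent n x) (Cotangent n x)).domRestrict (G.plus x)) := by
    rw [injective_iff_map_eq_zero]
    rintro ⟨⟨X, ξ⟩, hu⟩ h
    have hX : X = 0 := h
    subst hX
    by_contra hne
    have := G.posDef x _ hu (fun h0 ↦ hne (Subtype.ext h0))
    simp at this
  have h : Module.finrank ℝ (G.plus x) = Module.finrank ℝ (Tangent n x) :=
    (G.rank x).trans (finrank_tangent x).symm
  exact ⟨hinj, (LinearMap.injective_iff_surjective_of_finrank_eq_finrank
    (V := G.plus x) (V₂ := Tangent n x) h).1 hinj⟩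

theorem bijective_minus (G : GeneralizedMetric n M) (x : M) :
    Function.Bijective
      ((LinearMap.fst ℝ (Tangent n x) (Cotangent n x)).domRestrict (G.minus x)) := by
  have hinj : Function.Injective
      ((LinearMap.fst ℝ (Tangent n x) (Cotangent n x)).domRestrict (G.minus x)) := by
    rw [injective_iff_map_eq_zero]
    rintro ⟨⟨X, ξ⟩, hu⟩ h
    have hX : X = 0 := h
    subst hX
    have hξ : ξ = 0 := by
      ext Y
      obtain ⟨v, hv⟩ := (G.bijective_plus x).2 Y
      have h1 := hu v.1 v.2
      have h2 : (v.1).1 = Y := hv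
      have h3 : pairing x v.1 (0, ξ) = 0 := h1
      simpa [h2] using h3
    subst hξ
    rfl
  have h := Submodule.finrank_add_eq_of_isCompl (G.isCompl x)
  rw [Module.finrank_prod, finrank_tangent, finrank_cotangent] at h
  have h' : Module.finrank ℝ (G.plus x) = n := G.rank x
  have h2 : Module.finrank ℝ (G.minus x) = Module.finrank ℝ (Tangent n x) := by
    rw [finrank_tangent]
    omega
  exact ⟨hinj, (LinearMap.injective_iff_surjective_of_finrank_eq_finrank
    (V := G.minus x) (V₂ := Tangent n x) h2).1 hinj⟩

/-- `X⁺`, the section of `V⁺` with `π(X⁺) = X`. -/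
def liftPlus (G : GeneralizedMetric n M) (X : ∀ x : M, Tangent n x) (x : M) : GTangent n x :=
  ((LinearEquiv.ofBijective _ (G.bijective_plus x)).symm (X x) : G.plus x)

/-- `X⁻`, the section of `V⁻` with `π(X⁻) = X`. -/
def liftMinus (G : GeneralizedMetric n M) (X : ∀ x : M, Tangent n x) (x : M) : GTangent n x :=
  ((LinearEquiv.ofBijective _ (G.bijective_minus x)).symm (X x) : G.minus x)

/-- The projection `u ↦ u₊` of `E_x` onto `V⁺` along `V⁻`. -/
def projPlus (G : GeneralizedMetric n M) (x : M) : GTangent n x →ₗ[ℝ] G.plus x :=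
  Submodule.projectionOnto (G.plus x) (G.minus x) (G.isCompl x)

/-- The affine connection `∇⁺_X Y = π(([X⁻, Y⁺]_C)₊)` induced on `M`. -/
def connection (G : GeneralizedMetric n M) (X Y : SmoothField n M) (x : M) : Tangent n x :=
  (G.projPlus x (courant (G.liftMinus X.toFun) (G.liftPlus Y.toFun) x) : GTangent n x).1

end GeneralizedMetric

end GeneralizedGeometry

end

/-!
A `2`-form `B` acts on `E` by the `B`-field transform `e^B : X + ξ ↦ X + ξ + ι_X B`, which preserves
the pairing and the projection to `TM`. Cartan's calculus gives
`L_X ι_Y B - ι_Y d(ι_X B) = ι_[X,Y] B + ι_Y ι_X dB`, so `e^B` also preserves the Dorfman bracket,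
and hence the Courant bracket, as soon as `B` is closed. It then carries the lifts and the
projections of a generalized metric `V⁺` to those of `e^B V⁺`, and the connections agree because
`π ∘ e^B = π`. The theorem is the case `B = dα`.
-/

namespace GeneralizedGeometry

section BilinearValued

variable {E F G : Type*} [NormedAddCommGroup E] [NormedSpace ℝ E] [NormedAddCommGroup F]
  [NormedSpace ℝ F] [NormedAddCommGroup G] [NormedSpace ℝ G] {f : E → F →L[ℝ] F →L[ℝ] G} {p : E}

set_option synthInstance.maxHeartbeats 200000 in
-- The instances on iterated spaces of continuous linear maps are slow to find.
theorem differentiableAt_flip (hf : DifferentiableAt ℝ f p) :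
    DifferentiableAt ℝ (fun q ↦ (f q).flip) p := by
  have hflip : IsBoundedLinearMap ℝ (fun B : F →L[ℝ] F →L[ℝ] G ↦ B.flip) :=
    ⟨⟨fun _ _ ↦ rfl, fun _ _ ↦ rfl⟩, 1, one_pos, fun B ↦ by simp⟩
  exact DifferentiableAt.comp (𝕜 := ℝ) (F := F →L[ℝ] F →L[ℝ] G) (G := F →L[ℝ] F →L[ℝ] G) p
    hflip.differentiableAt hf

theorem fderiv_apply_apply (hf : DifferentiableAt ℝ f p) (u : E) (v w : F) :
    fderiv ℝ f p u v w = fderiv ℝ (fun q ↦ f q v w) p u := by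
  simp [fderiv_clm_apply, hf, DifferentiableAt.clm_apply]

end BilinearValued

section ModelCalculus

variable {n : ℕ} {θ η : Model n → Model n →L[ℝ] ℝ} {X Y : Model n → Model n}
  {β : Model n → Model n →L[ℝ] Model n →L[ℝ] ℝ} {p : Model n}

theorem extDerivModel_apply_apply (θ : Model n → Model n →L[ℝ] ℝ) (p u v : Model n) :
    extDerivModel θ p u v = fderiv ℝ θ p u v - fderiv ℝ θ p v u := by
  simp [extDerivModel]

theorem extDerivModel_swap (θ : Model n → Model n →L[ℝ] ℝ) (p u v : Model n) :
    extDerivModel θ p u v = -extDerivModel θ p v u := by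
  simp [extDerivModel]

theorem extDerivModel_add (hθ : DifferentiableAt ℝ θ p) (hη : DifferentiableAt ℝ η p) :
    extDerivModel (fun q ↦ θ q + η q) p = extDerivModel θ p + extDerivModel η p := by
  ext u v
  simp only [extDerivModel_apply_apply, add_apply, fderiv_fun_add hθ hη]
  ring

theorem lieDerivModel_add (X : Model n → Model n) (hθ : DifferentiableAt ℝ θ p)
    (hη : DifferentiableAt ℝ η p) :
    lieDerivModel X (fun q ↦ θ q + η q) p = lieDerivModel X θ p + lieDerivModel X η p := by
  simp only [lieDerivModel, add_apply, fderiv_fun_add hθ hη, ContinuousLinearMap.add_comp]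
  abel

theorem extDerivModel_congr (h : θ =ᶠ[𝓝 p] η) : extDerivModel θ p = extDerivModel η p := by
  rw [extDerivModel, extDerivModel, h.fderiv_eq]

theorem lieDerivModel_congr (X : Model n → Model n) (h : θ =ᶠ[𝓝 p] η) :
    lieDerivModel X θ p = lieDerivModel X η p := by
  rw [lieDerivModel, lieDerivModel, h.fderiv_eq, h.eq_of_nhds]

theorem extDerivModel_pullback {τ : Model n → Model n} (hθ : DifferentiableAt ℝ θ (τ p))
    (hτ : ContDiffAt ℝ 2 τ p) (u v : Model n) :
    extDerivModel (fun q ↦ (θ (τ q)).comp (fderiv ℝ τ q)) p u v =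
      extDerivModel θ (τ p) (fderiv ℝ τ p u) (fderiv ℝ τ p v) := by
  have hτ' : DifferentiableAt ℝ τ p := hτ.differentiableAt (by norm_num)
  have hτ'' : DifferentiableAt ℝ (fderiv ℝ τ) p :=
    (hτ.fderiv_right (m := 1) (by norm_num)).differentiableAt (by norm_num)
  have hsymm : fderiv ℝ (fderiv ℝ τ) p u v = fderiv ℝ (fderiv ℝ τ) p v u :=
    (hτ.isSymmSndFDerivAt (by simp)) u v
  have hθτ : HasFDerivAt (fun q ↦ θ (τ q)) ((fderiv ℝ θ (τ p)).comp (fderiv ℝ τ p)) p :=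
    hθ.hasFDerivAt.comp p hτ'.hasFDerivAt
  simp only [extDerivModel_apply_apply, (hθτ.clm_comp hτ''.hasFDerivAt).fderiv]
  simp [hsymm]

/-- The exterior derivative
`dβ(u, v, w) = (D_u β)(v, w) + (D_v β)(w, u) + (D_w β)(u, v)` of a `2`-form `β` on `ℝⁿ`; like
`extDerivModel` it is a plain function of its arguments, here not bundled as a multilinear map. -/
noncomputable def extDerivTwoModel (β : Model n → Model n →L[ℝ] Model n →L[ℝ] ℝ)
    (p u v w : Model n) : ℝ :=
  fderiv ℝ β p u v w + fderiv ℝ β p v w u + fderiv ℝ β p w u v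

theorem extDerivTwoModel_congr {γ : Model n → Model n →L[ℝ] Model n →L[ℝ] ℝ}
    (h : β =ᶠ[𝓝 p] γ) : extDerivTwoModel β p = extDerivTwoModel γ p := by
  funext u v w
  simp only [extDerivTwoModel, h.fderiv_eq]

set_option synthInstance.maxHeartbeats 60000 in
-- The instances on iterated spaces of continuous linear maps are slow to find.
theorem differentiableAt_extDerivModel (hθ : DifferentiableAt ℝ (fderiv ℝ θ) p) :
    DifferentiableAt ℝ (extDerivModel θ) p :=
  hθ.sub (𝕜 := ℝ) (F := Model n →L[ℝ] Model n →L[ℝ] ℝ) (differentiableAt_flip hθ)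

theorem fderiv_extDerivModel_apply (hθ : DifferentiableAt ℝ (fderiv ℝ θ) p) (u v w : Model n) :
    fderiv ℝ (extDerivModel θ) p u v w =
      fderiv ℝ (fderiv ℝ θ) p u v w - fderiv ℝ (fderiv ℝ θ) p u w v := by
  have hdiff (v w : Model n) : DifferentiableAt ℝ (fun q ↦ fderiv ℝ θ q v w) p := by fun_prop
  simp only [fderiv_apply_apply (differentiableAt_extDerivModel hθ), extDerivModel_apply_apply,
    fderiv_fun_sub (hdiff v w) (hdiff w v), sub_apply, fderiv_apply_apply hθ]

theorem extDerivTwoModel_extDerivModel (hθ : ContDiffAt ℝ 2 θ p) :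
    extDerivTwoModel (extDerivModel θ) p = 0 := by
  funext u v w
  have hsymm : IsSymmSndFDerivAt ℝ θ p := hθ.isSymmSndFDerivAt (by simp)
  have hθ' : DifferentiableAt ℝ (fderiv ℝ θ) p :=
    (hθ.fderiv_right (m := 1) (by norm_num)).differentiableAt (by norm_num)
  simp only [extDerivTwoModel, fderiv_extDerivModel_apply hθ', Pi.zero_apply]
  rw [hsymm u v, hsymm v w, hsymm w u]
  ring

theorem fderiv_swap_of_swap (hβ : DifferentiableAt ℝ β p)
    (hswap : ∀ q u v, β q u v = -β q v u) (u v w : Model n) :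
    fderiv ℝ β p u v w = -fderiv ℝ β p u w v := by
  rw [fderiv_apply_apply hβ, fderiv_apply_apply hβ, ← neg_apply, ← fderiv_fun_neg]
  simp only [← hswap]

theorem lieDerivModel_sub_extDerivModel_contract (hβ : DifferentiableAt ℝ β p)
    (hswap : ∀ q u v, β q u v = -β q v u) (hX : DifferentiableAt ℝ X p)
    (hY : DifferentiableAt ℝ Y p) (w : Model n) :
    lieDerivModel X (fun q ↦ β q (Y q)) p w - extDerivModel (fun q ↦ β q (X q)) p (Y p) w =
      β p (VectorField.lieBracket ℝ X Y p) w + extDerivTwoModel β p (X p) (Y p) w := by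
  have hleibniz {Z : Model n → Model n} (hZ : DifferentiableAt ℝ Z p) (u v : Model n) :
      fderiv ℝ (fun q ↦ β q (Z q)) p u v =
        β p (fderiv ℝ Z p u) v + fderiv ℝ β p u (Z p) v := by
    simp [fderiv_clm_apply hβ hZ]
  have hdβ := fderiv_swap_of_swap hβ hswap (Y p) (X p) w
  have hβX := hswap p (Y p) (fderiv ℝ X p w)
  simp only [lieDerivModel, add_apply, ContinuousLinearMap.comp_apply, extDerivModel_apply_apply,
    hleibniz hX, hleibniz hY, VectorField.lieBracket, map_sub, sub_apply, extDerivTwoModel]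
  linarith

end ModelCalculus

section Charts

variable {n : ℕ} {M : Type*} [TopologicalSpace M] [ChartedSpace (Model n) M]

/-- The derivative at `p` of the inverse of the chart at `x₀`, which carries vectors in `ℝⁿ` to
tangent vectors of `M`. -/
noncomputable def chartSymmDeriv (x₀ : M) (p : Model n) :
    Model n →L[ℝ] Tangent n ((extChartAt (𝓡 n) x₀).symm p) :=
  mfderivWithin 𝓘(ℝ, Model n) (𝓡 n) (extChartAt (𝓡 n) x₀).symm (range (𝓡 n)) p

/-- The expression in the chart at `x₀` of a field of bilinear forms. -/
noncomputable def bilinInChart (x₀ : M) (B : ∀ x : M, Tangent n x →L[ℝ] Cotangent n x)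
    (p : Model n) : Model n →L[ℝ] Model n →L[ℝ] ℝ :=
  (ContinuousLinearMap.precomp ℝ (chartSymmDeriv x₀ p)).comp
    ((B ((extChartAt (𝓡 n) x₀).symm p)).comp (chartSymmDeriv x₀ p))

/-- The exterior derivative `dξ` of a `1`-form, as a bilinear form on each tangent space. -/
noncomputable def extDerivForm (ξ : ∀ x : M, Cotangent n x) (x : M) :
    Tangent n x →L[ℝ] Cotangent n x :=
  (ContinuousLinearMap.precomp ℝ (chartDeriv x)).comp
    ((extDerivModel (formInChart x ξ) (extChartAt (𝓡 n) x x)).comp (chartDeriv x))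

-- All tangent spaces of `M` are definitionally `ℝⁿ`, so `v` is a vector at `x` and at `y` alike.
theorem covector_apply_congr (ξ : ∀ x : M, Cotangent n x) {x y : M} (h : x = y) (v : Model n) :
    ξ x v = ξ y v := by
  subst h
  rfl

theorem formInChart_apply (ξ : ∀ x : M, Cotangent n x) (x₀ : M) (p v : Model n) :
    formInChart x₀ ξ p v = ξ ((extChartAt (𝓡 n) x₀).symm p) (chartSymmDeriv x₀ p v) := rfl

theorem formInChart_add (ξ η : ∀ x : M, Cotangent n x) (x₀ : M) :
    formInChart x₀ (fun y ↦ ξ y + η y) = fun p ↦ formInChart x₀ ξ p + formInChart x₀ η p := rfl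

theorem bilinInChart_apply (B : ∀ x : M, Tangent n x →L[ℝ] Cotangent n x) (x₀ : M)
    (p u v : Model n) :
    bilinInChart x₀ B p u v =
      B ((extChartAt (𝓡 n) x₀).symm p) (chartSymmDeriv x₀ p u) (chartSymmDeriv x₀ p v) := rfl

theorem chartSymmDeriv_eq_mfderiv (x₀ : M) (p : Model n) :
    chartSymmDeriv x₀ p = mfderiv 𝓘(ℝ, Model n) (𝓡 n) (extChartAt (𝓡 n) x₀).symm p := by
  rw [chartSymmDeriv, ModelWithCorners.range_eq_univ, mfderivWithin_univ]

variable [IsManifold (𝓡 n) 1 M]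

theorem chartDeriv_self_apply (x : M) (v : Tangent n x) : chartDeriv x v = v :=
  DFunLike.congr_fun (mfderiv_extChartAt_self (I := 𝓡 n) (x := x)) v

theorem contractExtDeriv_eq_extDerivModel (ξ : ∀ x : M, Cotangent n x) (x : M) (u : Tangent n x) :
    contractExtDeriv ξ x u = extDerivModel (formInChart x ξ) (extChartAt (𝓡 n) x x) u := by
  refine ContinuousLinearMap.ext fun v ↦ ?_
  change extDerivModel _ _ (chartDeriv x u) (chartDeriv x v) = _
  rw [chartDeriv_self_apply, chartDeriv_self_apply]
  rfl

theorem lieDeriv_eq_lieDerivModel (X : ∀ x : M, Tangent n x) (ξ : ∀ x : M, Cotangent n x) (x : M) :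
    lieDeriv X ξ x =
      lieDerivModel (vectorInChart x X) (formInChart x ξ) (extChartAt (𝓡 n) x x) := by
  refine ContinuousLinearMap.ext fun v ↦ ?_
  change lieDerivModel _ _ _ (chartDeriv x v) = _
  rw [chartDeriv_self_apply]
  rfl

theorem vectorInChart_self (X : ∀ x : M, Tangent n x) (x : M) :
    vectorInChart x X (extChartAt (𝓡 n) x x) = X x :=
  (mfderivWithin_extChartAt_symm_inverse_apply (I := 𝓡 n) (x := x) _).trans
    (eq_of_heq (congr_arg_heq X (extChartAt_to_inv x)))

theorem bilinInChart_self (B : ∀ x : M, Tangent n x →L[ℝ] Cotangent n x) (x : M) :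
    bilinInChart x B (extChartAt (𝓡 n) x x) = B x := by
  have hid (v : Model n) : chartSymmDeriv x (extChartAt (𝓡 n) x x) v = v :=
    DFunLike.congr_fun (mfderivWithin_range_extChartAt_symm (I := 𝓡 n) (x := x)) v
  refine ContinuousLinearMap.ext fun u ↦ ContinuousLinearMap.ext fun v ↦ ?_
  rw [bilinInChart_apply, hid, hid]
  exact covector_apply_congr (fun y ↦ B y u) (extChartAt_to_inv x) v

theorem mlieBracket_eq_lieBracket (X Y : ∀ x : M, Tangent n x) (x : M) :
    VectorField.mlieBracket (𝓡 n) X Y x =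
      VectorField.lieBracket ℝ (vectorInChart x X) (vectorInChart x Y)
        (extChartAt (𝓡 n) x x) := by
  have hid : (mfderiv (𝓡 n) 𝓘(ℝ, Model n) (extChartAt (𝓡 n) x) x).inverse =
      ContinuousLinearMap.id ℝ (Model n) :=
    (congr_arg ContinuousLinearMap.inverse
      (mfderiv_extChartAt_self (I := 𝓡 n) (x := x))).trans ContinuousLinearMap.inverse_id
  have hrange : (extChartAt (𝓡 n) x).symm ⁻¹' univ ∩ range (𝓡 n) = univ := by
    simp
  rw [← VectorField.mlieBracketWithin_univ, VectorField.mlieBracketWithin_apply, hrange]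
  refine (DFunLike.congr_fun hid _).trans ?_
  exact congr_fun (VectorField.lieBracketWithin_univ (V := vectorInChart x X)
    (W := vectorInChart x Y)) _

theorem chartSymmDeriv_vectorInChart (X : ∀ x : M, Tangent n x) (x₀ : M) {p : Model n}
    (hp : p ∈ (extChartAt (𝓡 n) x₀).target) :
    chartSymmDeriv x₀ p (vectorInChart x₀ X p) = X ((extChartAt (𝓡 n) x₀).symm p) :=
  (isInvertible_mfderivWithin_extChartAt_symm hp).self_apply_inverse _

theorem formInChart_contract (B : ∀ x : M, Tangent n x →L[ℝ] Cotangent n x)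
    (X : ∀ x : M, Tangent n x) (x₀ : M) {p : Model n} (hp : p ∈ (extChartAt (𝓡 n) x₀).target) :
    formInChart x₀ (fun y ↦ B y (X y)) p = bilinInChart x₀ B p (vectorInChart x₀ X p) := by
  refine ContinuousLinearMap.ext fun v ↦ ?_
  rw [formInChart_apply, bilinInChart_apply, chartSymmDeriv_vectorInChart X x₀ hp]

theorem formInChart_contract_eventuallyEq (B : ∀ x : M, Tangent n x →L[ℝ] Cotangent n x)
    (X : ∀ x : M, Tangent n x) (x : M) :
    formInChart x (fun y ↦ B y (X y)) =ᶠ[𝓝 (extChartAt (𝓡 n) x x)]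
      fun p ↦ bilinInChart x B p (vectorInChart x X p) := by
  filter_upwards [extChartAt_target_mem_nhds (I := 𝓡 n) x] with p hp
  exact formInChart_contract B X x hp

theorem fderiv_transition_apply (x₀ y : M) {p : Model n}
    (hp : p ∈ (extChartAt (𝓡 n) x₀).target)
    (hy : (extChartAt (𝓡 n) x₀).symm p ∈ (extChartAt (𝓡 n) y).source) (v : Model n) :
    fderiv ℝ (extChartAt (𝓡 n) y ∘ (extChartAt (𝓡 n) x₀).symm) p v =
      mfderiv (𝓡 n) 𝓘(ℝ, Model n) (extChartAt (𝓡 n) y) ((extChartAt (𝓡 n) x₀).symm p)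
        (chartSymmDeriv x₀ p v) := by
  have hsymm : MDifferentiableAt 𝓘(ℝ, Model n) (𝓡 n) (extChartAt (𝓡 n) x₀).symm p :=
    (mdifferentiableOn_extChartAt_symm p hp).mdifferentiableAt
      ((isOpen_extChartAt_target x₀).mem_nhds hp)
  rw [← mfderiv_eq_fderiv, mfderiv_comp (I' := 𝓡 n) p
    (mdifferentiableAt_extChartAt (by simpa using hy)) hsymm, chartSymmDeriv_eq_mfderiv]
  rfl

theorem formInChart_eq_pullback_transition (ξ : ∀ x : M, Cotangent n x) (x₀ y : M)
    {p : Model n} (hp : p ∈ (extChartAt (𝓡 n) x₀).target)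
    (hy : (extChartAt (𝓡 n) x₀).symm p ∈ (extChartAt (𝓡 n) y).source) :
    formInChart x₀ ξ p =
      (formInChart y ξ ((extChartAt (𝓡 n) y ∘ (extChartAt (𝓡 n) x₀).symm) p)).comp
        (fderiv ℝ (extChartAt (𝓡 n) y ∘ (extChartAt (𝓡 n) x₀).symm) p) := by
  refine ContinuousLinearMap.ext fun v ↦ ?_
  rw [ContinuousLinearMap.comp_apply, formInChart_apply, formInChart_apply,
    fderiv_transition_apply x₀ y hp hy]
  have hpoint : (extChartAt (𝓡 n) x₀).symm p =
      (extChartAt (𝓡 n) y).symm ((extChartAt (𝓡 n) y ∘ (extChartAt (𝓡 n) x₀).symm) p) :=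
    ((extChartAt (𝓡 n) y).left_inv hy).symm
  refine Eq.trans ?_ (covector_apply_congr ξ hpoint _)
  exact congr_arg (ξ _) (DFunLike.congr_fun
    (mfderivWithin_extChartAt_symm_comp_mfderiv_extChartAt' (I := 𝓡 n) hy) _).symm

end Charts

section SmoothCharts

variable {n : ℕ} {M : Type*} [TopologicalSpace M] [ChartedSpace (Model n) M]
  [IsManifold (𝓡 n) ∞ M] {X : ∀ x : M, Tangent n x} {ξ : ∀ x : M, Cotangent n x}

theorem contDiffAt_vectorInChart (hX : SmoothVectorOn X univ) (x : M) :
    ContDiffAt ℝ ∞ (vectorInChart x X) (extChartAt (𝓡 n) x x) := by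
  have h := VectorField.contMDiffWithinAt_mpullbackWithin_extChartAt_symm (m := ∞) (n := ∞)
    (hX x (mem_univ x)) uniqueMDiffOn_univ (mem_univ x) (by simp)
  rw [preimage_univ, inter_univ] at h
  exact (contMDiffWithinAt_vectorSpace_iff_contDiffWithinAt.1 h).contDiffAt
    (extChartAt_target_mem_nhds x)

theorem inCoordinates_eq_formInChart (ξ : ∀ x : M, Cotangent n x) (x₀ : M) {y : M}
    (hy : y ∈ (chartAt (Model n) x₀).source) :
    ContinuousLinearMap.inCoordinates (Model n) (fun x : M ↦ TangentSpace (𝓡 n) x) ℝ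
      (fun _ : M ↦ ℝ) x₀ y x₀ y (ξ y) = formInChart x₀ ξ (extChartAt (𝓡 n) x₀ y) := by
  refine ContinuousLinearMap.ext fun v ↦ ?_
  have hpoint : (extChartAt (𝓡 n) x₀).symm (extChartAt (𝓡 n) x₀ y) = y :=
    (extChartAt (𝓡 n) x₀).left_inv (by simpa using hy)
  have hsymmL := DFunLike.congr_fun (TangentBundle.symmL_trivializationAt (I := 𝓡 n) hy) v
  calc _ = ξ y ((trivializationAt (Model n) (TangentSpace (𝓡 n)) x₀).symmL ℝ y v) := by
        simp [ContinuousLinearMap.inCoordinates]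
    _ = ξ y _ := congr_arg (ξ y) hsymmL
    _ = _ := covector_apply_congr ξ hpoint.symm _

theorem contDiffAt_formInChart (hξ : SmoothCovectorOn ξ univ) (x : M) :
    ContDiffAt ℝ ∞ (formInChart x ξ) (extChartAt (𝓡 n) x x) := by
  have hcoord := ((contMDiffAt_hom_bundle _).1
    ((hξ x (mem_univ x)).contMDiffAt Filter.univ_mem)).2
  have hsymm : ContMDiffAt 𝓘(ℝ, Model n) (𝓡 n) ∞ (extChartAt (𝓡 n) x).symm
      (extChartAt (𝓡 n) x x) :=
    (contMDiffOn_extChartAt_symm x).contMDiffAt (extChartAt_target_mem_nhds x)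
  have hcomp := ContMDiffAt.comp_of_eq hcoord hsymm (extChartAt_to_inv x)
  refine (contMDiffAt_iff_contDiffAt.1 hcomp).congr_of_eventuallyEq ?_
  filter_upwards [extChartAt_target_mem_nhds (I := 𝓡 n) x] with q hq
  have hq' := inCoordinates_eq_formInChart ξ x (y := (extChartAt (𝓡 n) x).symm q)
    (by simpa using (extChartAt (𝓡 n) x).map_target hq)
  rw [(extChartAt (𝓡 n) x).right_inv hq] at hq'
  exact hq'.symm

theorem bilinInChart_extDerivForm (hξ : SmoothCovectorOn ξ univ) (x₀ : M) {p : Model n}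
    (hp : p ∈ (extChartAt (𝓡 n) x₀).target) :
    bilinInChart x₀ (extDerivForm ξ) p = extDerivModel (formInChart x₀ ξ) p := by
  set y := (extChartAt (𝓡 n) x₀).symm p
  have hy : y ∈ (extChartAt (𝓡 n) y).source := mem_extChartAt_source y
  set τ : Model n → Model n := extChartAt (𝓡 n) y ∘ (extChartAt (𝓡 n) x₀).symm with hτ_def
  have hτ : ContDiffAt ℝ 2 τ p := by
    have h := contDiffWithinAt_ext_coord_change (I := 𝓡 n) (n := ∞) y x₀ (y := p)
      ⟨hp, hy⟩
    rw [ModelWithCorners.range_eq_univ, contDiffWithinAt_univ] at h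
    exact h.of_le (WithTop.coe_le_coe.2 le_top)
  have hpullback : formInChart x₀ ξ =ᶠ[𝓝 p]
      fun q ↦ (formInChart y ξ (τ q)).comp (fderiv ℝ τ q) := by
    filter_upwards [(isOpen_extChartAt_target x₀).mem_nhds hp,
      (continuousAt_extChartAt_symm'' hp).preimage_mem_nhds
        (extChartAt_source_mem_nhds (I := 𝓡 n) y)]
      with q hq hq'
    exact formInChart_eq_pullback_transition ξ x₀ y hq hq'
  refine ContinuousLinearMap.ext fun u ↦ ContinuousLinearMap.ext fun v ↦ ?_
  rw [extDerivModel_congr hpullback, extDerivModel_pullback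
    ((contDiffAt_formInChart hξ y).differentiableAt (by simp)) hτ, hτ_def,
    fderiv_transition_apply x₀ y hp hy, fderiv_transition_apply x₀ y hp hy]
  rfl

end SmoothCharts

section ClosedTwoForm

variable {n : ℕ} {M : Type*} [TopologicalSpace M] [ChartedSpace (Model n) M]
  {B : ∀ x : M, Tangent n x →L[ℝ] Cotangent n x}

/-- A closed `2`-form on `M`, given as the skew maps `u ↦ ι_u B` from `TM` to `T*M`. Of regularity
only differentiability is required, and this and `dB = 0` are read at each `x` in the preferred
chart at `x`, as for `lieDeriv` and `contractExtDeriv`. -/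
structure IsClosedTwoForm (B : ∀ x : M, Tangent n x →L[ℝ] Cotangent n x) : Prop where
  swap : ∀ x u v, B x u v = -B x v u
  differentiableAt : ∀ x, DifferentiableAt ℝ (bilinInChart x B) (extChartAt (𝓡 n) x x)
  closed : ∀ x, extDerivTwoModel (bilinInChart x B) (extChartAt (𝓡 n) x x) = 0

/-- The section `e = X + ξ` of `TM ⊕ T*M` is differentiable at `x`: the expressions of `X` and `ξ`
in the preferred chart at `x` are. -/
structure DifferentiableSectionAt (e : ∀ x : M, GTangent n x) (x : M) : Prop where
  vector : DifferentiableAt ℝ (vectorInChart x fun y ↦ (e y).1) (extChartAt (𝓡 n) x x)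
  covector : DifferentiableAt ℝ (formInChart x fun y ↦ (e y).2) (extChartAt (𝓡 n) x x)

/-- The `B`-field transform `X + ξ ↦ X + ξ + ι_X β` of `E_x`. -/
noncomputable def bTransform {x : M} (β : Tangent n x →L[ℝ] Cotangent n x) :
    GTangent n x →ₗ[ℝ] GTangent n x :=
  (LinearMap.fst ℝ _ _).prod (LinearMap.snd ℝ _ _ + β.toLinearMap ∘ₗ LinearMap.fst ℝ _ _)

theorem bTransform_apply {x : M} (β : Tangent n x →L[ℝ] Cotangent n x) (u : GTangent n x) :
    bTransform β u = (u.1, u.2 + β u.1) := rfl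

theorem pairing_bTransform {x : M} {β : Tangent n x →L[ℝ] Cotangent n x}
    (hβ : ∀ u v, β u v = -β v u) (u v : GTangent n x) :
    pairing x (bTransform β u) (bTransform β v) = pairing x u v := by
  simp only [pairing_apply, bTransform_apply, add_apply, hβ v.1 u.1]
  ring

theorem isClosedTwoForm_extDerivForm [IsManifold (𝓡 n) ∞ M] {ξ : ∀ x : M, Cotangent n x}
    (hξ : SmoothCovectorOn ξ univ) : IsClosedTwoForm (extDerivForm ξ) := by
  have hchart (x : M) : bilinInChart x (extDerivForm ξ) =ᶠ[𝓝 (extChartAt (𝓡 n) x x)]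
      extDerivModel (formInChart x ξ) := by
    filter_upwards [extChartAt_target_mem_nhds (I := 𝓡 n) x] with p hp
    exact bilinInChart_extDerivForm hξ x hp
  have hsmooth (x : M) : ContDiffAt ℝ 2 (formInChart x ξ) (extChartAt (𝓡 n) x x) :=
    (contDiffAt_formInChart hξ x).of_le (WithTop.coe_le_coe.2 le_top)
  refine ⟨fun x u v ↦ extDerivModel_swap _ _ _ _, fun x ↦ ?_, fun x ↦ ?_⟩
  · have hfderiv := ((hsmooth x).fderiv_right (m := 1) (by norm_num)).differentiableAt (by norm_num)
    exact (differentiableAt_extDerivModel hfderiv).congr_of_eventuallyEq (hchart x)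
  · rw [extDerivTwoModel_congr (hchart x), extDerivTwoModel_extDerivModel (hsmooth x)]

variable [IsManifold (𝓡 n) 1 M] {X Y : ∀ x : M, Tangent n x} {ξ η : ∀ x : M, Cotangent n x} {x : M}

theorem lieDeriv_add (hξ : DifferentiableAt ℝ (formInChart x ξ) (extChartAt (𝓡 n) x x))
    (hη : DifferentiableAt ℝ (formInChart x η) (extChartAt (𝓡 n) x x)) :
    lieDeriv X (fun y ↦ ξ y + η y) x = lieDeriv X ξ x + lieDeriv X η x := by
  simp only [lieDeriv_eq_lieDerivModel, formInChart_add, lieDerivModel_add _ hξ hη]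
  rfl

theorem contractExtDeriv_add (hξ : DifferentiableAt ℝ (formInChart x ξ) (extChartAt (𝓡 n) x x))
    (hη : DifferentiableAt ℝ (formInChart x η) (extChartAt (𝓡 n) x x)) (u : Tangent n x) :
    contractExtDeriv (fun y ↦ ξ y + η y) x u =
      contractExtDeriv ξ x u + contractExtDeriv η x u := by
  simp only [contractExtDeriv_eq_extDerivModel, formInChart_add, extDerivModel_add hξ hη]
  rfl

namespace IsClosedTwoForm

theorem differentiableAt_contract (hB : IsClosedTwoForm B)
    (hX : DifferentiableAt ℝ (vectorInChart x X) (extChartAt (𝓡 n) x x)) :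
    DifferentiableAt ℝ (formInChart x fun y ↦ B y (X y)) (extChartAt (𝓡 n) x x) :=
  ((hB.differentiableAt x).clm_apply hX).congr_of_eventuallyEq
    (formInChart_contract_eventuallyEq B X x)

theorem lieDeriv_sub_contractExtDeriv (hB : IsClosedTwoForm B)
    (hX : DifferentiableAt ℝ (vectorInChart x X) (extChartAt (𝓡 n) x x))
    (hY : DifferentiableAt ℝ (vectorInChart x Y) (extChartAt (𝓡 n) x x)) :
    lieDeriv X (fun y ↦ B y (Y y)) x - contractExtDeriv (fun y ↦ B y (X y)) x (Y x) =
      B x (VectorField.mlieBracket (𝓡 n) X Y x) := by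
  refine ContinuousLinearMap.ext fun w ↦ ?_
  have hcartan := lieDerivModel_sub_extDerivModel_contract (hB.differentiableAt x)
    (fun q u v ↦ hB.swap _ _ _) hX hY w
  rw [hB.closed, bilinInChart_self, vectorInChart_self, ← mlieBracket_eq_lieBracket,
    ← lieDerivModel_congr _ (formInChart_contract_eventuallyEq B Y x),
    ← extDerivModel_congr (formInChart_contract_eventuallyEq B X x)] at hcartan
  rw [lieDeriv_eq_lieDerivModel, contractExtDeriv_eq_extDerivModel]
  exact hcartan.trans (add_zero _)

theorem dorfman_bTransform (hB : IsClosedTwoForm B) {e₁ e₂ : ∀ x : M, GTangent n x}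
    (h₁ : DifferentiableSectionAt e₁ x) (h₂ : DifferentiableSectionAt e₂ x) :
    dorfman (fun y ↦ bTransform (B y) (e₁ y)) (fun y ↦ bTransform (B y) (e₂ y)) x =
      bTransform (B x) (dorfman e₁ e₂ x) := by
  refine Prod.ext rfl ?_
  simp only [dorfman, bTransform_apply]
  rw [lieDeriv_add h₂.covector (hB.differentiableAt_contract h₂.vector),
    contractExtDeriv_add h₁.covector (hB.differentiableAt_contract h₁.vector),
    ← hB.lieDeriv_sub_contractExtDeriv h₁.vector h₂.vector]
  exact add_sub_add_comm _ _ _ _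

theorem courant_bTransform (hB : IsClosedTwoForm B) {e₁ e₂ : ∀ x : M, GTangent n x}
    (h₁ : DifferentiableSectionAt e₁ x) (h₂ : DifferentiableSectionAt e₂ x) :
    courant (fun y ↦ bTransform (B y) (e₁ y)) (fun y ↦ bTransform (B y) (e₂ y)) x =
      bTransform (B x) (courant e₁ e₂ x) := by
  rw [courant, courant, hB.dorfman_bTransform h₁ h₂, hB.dorfman_bTransform h₂ h₁, map_smul,
    map_sub]

end IsClosedTwoForm

end ClosedTwoForm

section SmoothSections

variable {n : ℕ} {M : Type*} [TopologicalSpace M] [ChartedSpace (Model n) M]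
  [IsManifold (𝓡 n) ∞ M] {U : Set M} {X : ∀ x : M, Tangent n x} {ξ η : ∀ x : M, Cotangent n x}

theorem SmoothCovectorOn.add (hξ : SmoothCovectorOn ξ U) (hη : SmoothCovectorOn η U) :
    SmoothCovectorOn (fun x ↦ ξ x + η x) U :=
  ContMDiffOn.add_section hξ hη

theorem SmoothCovectorOn.neg (hξ : SmoothCovectorOn ξ U) : SmoothCovectorOn (fun x ↦ -ξ x) U :=
  ContMDiffOn.neg_section hξ

theorem SmoothVectorOn.metric_contract (hX : SmoothVectorOn X U) (g : RiemannianMetric n M) :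
    SmoothCovectorOn (fun x ↦ g.inner x (X x)) U :=
  ContMDiffOn.clm_bundle_apply g.contMDiff.contMDiffOn hX

theorem SmoothVectorOn.twoForm_contract (hX : SmoothVectorOn X U) (b : TwoForm n M) :
    SmoothCovectorOn (fun x ↦ b.toFun x (X x)) U :=
  ContMDiffOn.clm_bundle_apply b.smooth.contMDiffOn hX

theorem SmoothVectorOn.differentiableSectionAt (hX : SmoothVectorOn X univ)
    (hξ : SmoothCovectorOn ξ univ) (x : M) : DifferentiableSectionAt (fun y ↦ (X y, ξ y)) x :=
  ⟨(contDiffAt_vectorInChart hX x).differentiableAt (by simp),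
    (contDiffAt_formInChart hξ x).differentiableAt (by simp)⟩

theorem TwoForm.swap (b : TwoForm n M) (x : M) (u v : Tangent n x) :
    b.toFun x u v = -b.toFun x v u := by
  have h := b.alternating x (u + v)
  simp only [map_add, add_apply, b.alternating, zero_add, add_zero] at h
  linarith

end SmoothSections

namespace GeneralizedMetric

variable {n : ℕ} {M : Type*} [TopologicalSpace M] [ChartedSpace (Model n) M]
  [IsManifold (𝓡 n) ∞ M] (G : GeneralizedMetric n M) (X : ∀ x : M, Tangent n x) {x : M}

theorem liftPlus_mem (x : M) : G.liftPlus X x ∈ G.plus x := Subtype.property _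

theorem liftMinus_mem (x : M) : G.liftMinus X x ∈ G.minus x := Subtype.property _

theorem liftPlus_fst (x : M) : (G.liftPlus X x).1 = X x :=
  (LinearEquiv.ofBijective _ (G.bijective_plus x)).apply_symm_apply (X x)

theorem liftMinus_fst (x : M) : (G.liftMinus X x).1 = X x :=
  (LinearEquiv.ofBijective _ (G.bijective_minus x)).apply_symm_apply (X x)

variable {X}

theorem liftPlus_eq {u : GTangent n x} (hu : u ∈ G.plus x) (h : u.1 = X x) :
    G.liftPlus X x = u :=
  congr_arg Subtype.val ((G.bijective_plus x).1 (a₁ := ⟨_, G.liftPlus_mem X x⟩) (a₂ := ⟨u, hu⟩)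
    ((G.liftPlus_fst X x).trans h.symm))

theorem liftMinus_eq {u : GTangent n x} (hu : u ∈ G.minus x) (h : u.1 = X x) :
    G.liftMinus X x = u :=
  congr_arg Subtype.val ((G.bijective_minus x).1 (a₁ := ⟨_, G.liftMinus_mem X x⟩) (a₂ := ⟨u, hu⟩)
    ((G.liftMinus_fst X x).trans h.symm))

theorem projPlus_add_of_mem {u v : GTangent n x} (hu : u ∈ G.plus x) (hv : v ∈ G.minus x) :
    (G.projPlus x (u + v) : GTangent n x) = u := by
  have hplus : G.projPlus x u = ⟨u, hu⟩ :=
    Submodule.projectionOnto_apply_left (G.isCompl x) ⟨u, hu⟩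
  have hminus : G.projPlus x v = 0 :=
    Submodule.projectionOnto_apply_right (G.isCompl x) ⟨v, hv⟩
  rw [map_add, hplus, hminus, add_zero]

section BTransform

variable {V W : GeneralizedMetric n M} {β : Tangent n x →L[ℝ] Cotangent n x}

theorem bTransform_mem_plus (hVW : W.plus x = (V.plus x).map (bTransform β)) {u : GTangent n x}
    (hu : u ∈ V.plus x) : bTransform β u ∈ W.plus x :=
  hVW ▸ Submodule.mem_map_of_mem hu

theorem bTransform_mem_minus (hβ : ∀ u v, β u v = -β v u)
    (hVW : W.plus x = (V.plus x).map (bTransform β)) {u : GTangent n x} (hu : u ∈ V.minus x) :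
    bTransform β u ∈ W.minus x := by
  intro w hw
  obtain ⟨v, hv, rfl⟩ := hVW.le hw
  exact (pairing_bTransform hβ v u).trans (hu v hv)

theorem liftPlus_bTransform (hVW : W.plus x = (V.plus x).map (bTransform β)) :
    W.liftPlus X x = bTransform β (V.liftPlus X x) :=
  W.liftPlus_eq (bTransform_mem_plus hVW (V.liftPlus_mem X x)) (V.liftPlus_fst X x)

theorem liftMinus_bTransform (hβ : ∀ u v, β u v = -β v u)
    (hVW : W.plus x = (V.plus x).map (bTransform β)) :
    W.liftMinus X x = bTransform β (V.liftMinus X x) :=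
  W.liftMinus_eq (bTransform_mem_minus hβ hVW (V.liftMinus_mem X x)) (V.liftMinus_fst X x)

theorem projPlus_bTransform (hβ : ∀ u v, β u v = -β v u)
    (hVW : W.plus x = (V.plus x).map (bTransform β)) (u : GTangent n x) :
    (W.projPlus x (bTransform β u) : GTangent n x) = bTransform β (V.projPlus x u) := by
  obtain ⟨v, hv, w, hw, rfl⟩ := Submodule.mem_sup.1
    ((V.isCompl x).sup_eq_top ▸ Submodule.mem_top : u ∈ V.plus x ⊔ V.minus x)
  rw [map_add, V.projPlus_add_of_mem hv hw,
    W.projPlus_add_of_mem (bTransform_mem_plus hVW hv) (bTransform_mem_minus hβ hVW hw)]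

theorem connection_eq_of_plus_eq_map {B : ∀ x : M, Tangent n x →L[ℝ] Cotangent n x}
    (hB : IsClosedTwoForm B) (hVW : ∀ x, W.plus x = (V.plus x).map (bTransform (B x)))
    {X Y : SmoothField n M} (hX : DifferentiableSectionAt (V.liftMinus X.toFun) x)
    (hY : DifferentiableSectionAt (V.liftPlus Y.toFun) x) :
    V.connection X Y x = W.connection X Y x := by
  have hminus : W.liftMinus X.toFun = fun y ↦ bTransform (B y) (V.liftMinus X.toFun y) :=
    funext fun y ↦ liftMinus_bTransform (hB.swap y) (hVW y)
  have hplus : W.liftPlus Y.toFun = fun y ↦ bTransform (B y) (V.liftPlus Y.toFun y) :=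
    funext fun y ↦ liftPlus_bTransform (hVW y)
  rw [connection, connection, hminus, hplus, hB.courant_bTransform hX hY,
    projPlus_bTransform (hB.swap x) (hVW x)]
  rfl

end BTransform

section Graph

variable {G}

theorem liftPlus_of_graph {A : Tangent n x → Cotangent n x}
    (hG : (G.plus x : Set (GTangent n x)) = range fun u ↦ (u, A u)) :
    G.liftPlus X x = (X x, A (X x)) :=
  G.liftPlus_eq (hG.ge ⟨X x, rfl⟩) rfl

theorem liftMinus_of_graph {γ β : Tangent n x →L[ℝ] Cotangent n x} (hγ : ∀ u v, γ u v = γ v u)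
    (hβ : ∀ u v, β u v = -β v u)
    (hG : (G.plus x : Set (GTangent n x)) = range fun u ↦ (u, γ u + β u)) :
    G.liftMinus X x = (X x, -γ (X x) + β (X x)) := by
  refine G.liftMinus_eq (fun w hw ↦ ?_) rfl
  obtain ⟨u, rfl⟩ := hG.le hw
  change pairing x (u, γ u + β u) (X x, -γ (X x) + β (X x)) = 0
  simp only [pairing_apply, add_apply, neg_apply, hγ u, hβ u]
  ring

end Graph

end GeneralizedMetric

open GeneralizedMetric in
theorem mainTheorem4_general {n : ℕ} {M : Type*} [TopologicalSpace M] [ChartedSpace (Model n) M]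
    [IsManifold (𝓡 n) ∞ M] (g : RiemannianMetric n M) (b : TwoForm n M)
    {B : ∀ x : M, Tangent n x →L[ℝ] Cotangent n x} (hB : IsClosedTwoForm B)
    (V W : GeneralizedMetric n M)
    (hV : ∀ x : M, (V.plus x : Set (GTangent n x)) =
      range fun X : Tangent n x ↦ (X, g.inner x X + b.toFun x X))
    (hW : ∀ x : M, (W.plus x : Set (GTangent n x)) =
      range fun X : Tangent n x ↦ (X, g.inner x X + b.toFun x X + B x X))
    (X Y : SmoothField n M) (x : M) : V.connection X Y x = W.connection X Y x := by
  have hVW (x : M) : W.plus x = (V.plus x).map (bTransform (B x)) := by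
    refine SetLike.coe_injective ?_
    rw [Submodule.map_coe, hV, hW, ← range_comp]
    rfl
  have hX : V.liftMinus X.toFun = fun y ↦
      (X.toFun y, -g.inner y (X.toFun y) + b.toFun y (X.toFun y)) :=
    funext fun y ↦ liftMinus_of_graph (g.symm y) (b.swap y) (hV y)
  have hY : V.liftPlus Y.toFun = fun y ↦
      (Y.toFun y, g.inner y (Y.toFun y) + b.toFun y (Y.toFun y)) :=
    funext fun y ↦ liftPlus_of_graph (hV y)
  refine connection_eq_of_plus_eq_map hB hVW ?_ ?_
  · rw [hX]
    exact X.smooth.differentiableSectionAt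
      ((X.smooth.metric_contract g).neg.add (X.smooth.twoForm_contract b)) x
  · rw [hY]
    exact Y.smooth.differentiableSectionAt
      ((Y.smooth.metric_contract g).add (Y.smooth.twoForm_contract b)) x

end GeneralizedGeometry

theorem mainTheorem4 {n : ℕ} {M : Type*} [TopologicalSpace M]
    [ChartedSpace (GeneralizedGeometry.Model n) M] [IsManifold (𝓡 n) ∞ M]
    (g : GeneralizedGeometry.RiemannianMetric n M) (b : GeneralizedGeometry.TwoForm n M)
    (α : GeneralizedGeometry.OneForm n M) (V W : GeneralizedGeometry.GeneralizedMetric n M)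
    (hV : ∀ x : M, (V.plus x : Set (GeneralizedGeometry.GTangent n x)) =
      Set.range fun X : GeneralizedGeometry.Tangent n x ↦ (X, g.inner x X + b.toFun x X))
    (hW : ∀ x : M, (W.plus x : Set (GeneralizedGeometry.GTangent n x)) =
      Set.range fun X : GeneralizedGeometry.Tangent n x ↦
        (X, g.inner x X + b.toFun x X + GeneralizedGeometry.contractExtDeriv α.toFun x X)) :
    ∀ (X Y : GeneralizedGeometry.SmoothField n M) (x : M),
      V.connection X Y x = W.connection X Y x :=
  GeneralizedGeometry.mainTheorem4_general g b
    (GeneralizedGeometry.isClosedTwoForm_extDerivForm α.smooth) V W hV hW
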